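/- Let $K$ be a field of characteristic $0$ with $\sqrt5\notin K$, i.e. such that $5$ is not a square in $K$, and suppose that $-1$ is a sum of two squares in $K(\sqrt5)$. Let $\mathbb{Z}/2\mathbb{Z}$ act on $\mathrm{PGL}_2(K(\sqrt5))$ so that its nontrivial element applies the Galois involution of $K(\sqrt5)/K$ to the entries of matrices. Then $$J\bigl(\mathrm{PGL}_2(K(\sqrt5))\rtimes\mathbb{Z}/2\mathbb{Z}\bigr)=120.$$ Here, for a finite group $G$, $J(G)$ denotes the smallest index of a normal abelian subgroup of $G$, and for an arbitrary group $\Gamma$, $J(\Gamma)=\sup J(G)$ over all finite subgroups $G\subseteq\Gamma$. -/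

import Mathlib

open scoped MatrixGroups

/-- The Jordan constant of a finite group `G`: the smallest index of a normal abelian subgroup. -/
noncomputable def finiteJordanConstant (G : Type*) [Group G] [Finite G] : ℕ :=
  sInf {n : ℕ | ∃ A : Subgroup G, A.Normal ∧ IsMulCommutative A ∧ A.index = n}

/-- The Jordan constant of an arbitrary group `Γ`: the supremum, in `ℕ ∪ {∞}`, of the Jordan
constants of its finite subgroups. The group is Jordan exactly when this value is finite. -/
noncomputable def jordanConstant (Γ : Type*) [Group Γ] : ℕ∞ :=
  ⨆ (G : Subgroup Γ) (_ : Finite G), (finiteJordanConstant G : ℕ∞)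

/-- The homomorphism `PGL₂(R) → PGL₂(S)` that applies a ring homomorphism `R → S` to the entries
of a matrix. -/
def pglMap {R S : Type*} [CommRing R] [CommRing S] (f : R →+* S) : PGL(2, R) →* PGL(2, S) :=
  Matrix.ProjGenLinGroup.lift
    (Matrix.ProjGenLinGroup.mk.comp (Matrix.GeneralLinearGroup.map f)) <| by
      ext u
      have h : Matrix.GeneralLinearGroup.map f (Matrix.GeneralLinearGroup.scalar (Fin 2) u)
          = Matrix.GeneralLinearGroup.scalar (Fin 2) (Units.map f.toMonoidHom u) := by
        ext i j
        fin_cases i <;> fin_cases j <;> simp [Matrix.scalar_apply]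
      simp [h]

theorem pglMap_mk {R S : Type*} [CommRing R] [CommRing S] (f : R →+* S) (g : GL (Fin 2) R) :
    pglMap f (Matrix.ProjGenLinGroup.mk g)
      = Matrix.ProjGenLinGroup.mk (Matrix.GeneralLinearGroup.map f g) := rfl

/-- The entrywise action of `Gal(L/K)` on `PGL₂(L)` by group automorphisms. -/
def galoisActionPGL (K L : Type*) [Field K] [Field L] [Algebra K L] :
    (L ≃ₐ[K] L) →* MulAut PGL(2, L) where
  toFun σ :=
    { toFun := pglMap (σ : L →+* L)
      invFun := pglMap ((σ⁻¹ : L ≃ₐ[K] L) : L →+* L)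
      left_inv := fun x => by
        induction x using Matrix.ProjGenLinGroup.induction_on with | mk g =>
        rw [pglMap_mk, pglMap_mk]
        congr 1
        ext i j
        simp
      right_inv := fun x => by
        induction x using Matrix.ProjGenLinGroup.induction_on with | mk g =>
        rw [pglMap_mk, pglMap_mk]
        congr 1
        ext i j
        simp
      map_mul' := map_mul _ }
  map_one' := by
    ext x
    induction x using Matrix.ProjGenLinGroup.induction_on with | mk g => rfl
  map_mul' σ τ := by
    ext x
    induction x using Matrix.ProjGenLinGroup.induction_on with | mk g => rfl

/-- The homomorphism from `ℤ/2ℤ` (written multiplicatively) to a group that sends the nontrivial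
element to a given element `g` of order two. -/
def involutionHom {G : Type*} [Group G] (g : G) (hg : orderOf g = 2) :
    Multiplicative (ZMod 2) →* G where
  toFun i := g ^ (Multiplicative.toAdd i).val
  map_one' := by simp
  map_mul' i j := by
    have h (n : ℕ) : g ^ (n % 2) = g ^ n := by
      simpa only [hg] using pow_mod_orderOf g n
    rw [toAdd_mul, ZMod.val_add, h, pow_add]

/-- The semidirect product `PGL₂(L) ⋊ ℤ/2ℤ`, where the nontrivial element of `ℤ/2ℤ` acts by
applying the involution `σ` of `L` over `K` to the entries of a matrix. -/
abbrev PGLSemidirect {K L : Type*} [Field K] [Field L] [Algebra K L]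
    (σ : L ≃ₐ[K] L) (hσ : orderOf σ = 2) : Type _ :=
  PGL(2, L) ⋊[(galoisActionPGL K L).comp (involutionHom σ hσ)] Multiplicative (ZMod 2)

/-!
Write `Γ = PGL₂(L) ⋊ ℤ/2ℤ`.

**Upper bound.** A finite `G ≤ Γ` meets `PGL₂(L)` in a subgroup `H` of index at most two. Over an
algebraic closure `F` of `L`, every nontrivial element of `H` is diagonalizable, because a parabolic
element has infinite order in characteristic zero; so it has exactly two fixed points on the
projective line. The stabilizer of a point in `H` is abelian, since a commutator of two matrices
with a common eigenvector is scalar or parabolic. Burnside's count of orbits on the set of points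
with nontrivial stabilizer then gives `|H| ≤ 60` or a stabilizer of index at most two
(`card_le_sixty_or_exists_isMulCommutative_of_pgl`). This avoids the full classification of `H`. In
the first case `|G| ≤ 120`; in the second `G` has an abelian subgroup of index at most four, whose
normal core has index at most `4! = 24`.

**Lower bound.** It suffices to embed `S₅` into `Γ`, as a commutative normal subgroup of `S₅` is
trivial. Since `-1` is a sum of two squares in `L`, the matrix algebra `M₂(L)` is the quaternion
algebra `(-1, -1)` over `L`, and the determinant is the quaternion norm. Following the entrywise
action of `σ` by conjugation with a suitable matrix `C` gives the map `σ'` that applies `σ` to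
quaternion coordinates (`exists_quaternion_descent`). On the four-dimensional `K`-space of
quaternions `v` with `σ' v = v̄`, that is `K ⊕ √5 (Ki ⊕ Kj ⊕ Kk)`, the norm form contains the
vertices `v₀, …, v₄` of a regular simplex centred at the origin; this is where `√5` enters. The
elements `v_a σ'` of `Γ` are five involutions with trivial common centralizer, and `(v_a - v_b) σ'`,
which acts as the reflection in `v_a - v_b`, permutes them by the transposition `(a b)` under
conjugation. Such a configuration determines an injective homomorphism from `S₅`
(`exists_injective_perm_hom`).
-/

open Matrix Matrix.GeneralLinearGroup

/-! ### Finite groups whose nontrivial elements have two fixed points -/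

/-- The arithmetic of the orbit count: `d ω` and `e ω` are the sizes of the orbit `ω` and of its
stabilizers in a group of order `n`, and the equation says `∑ ω, (1 - 1 / e ω) = 2 - 2 / n`. Unless
`n = 1` or some orbit has at most two points, there are three orbits and the triple `e` is `(2, 3, 3)`,
`(2, 3, 4)` or `(2, 3, 5)`. -/
theorem le_sixty_or_exists_le_two {Ω : Type*} [Fintype Ω] (n : ℕ) (d e : Ω → ℕ)
    (hed : ∀ ω, e ω * d ω = n) (he : ∀ ω, 2 ≤ e ω)
    (h : 2 * n + ∑ ω, d ω = Fintype.card Ω * n + 2) : n ≤ 60 ∨ ∃ ω, d ω ≤ 2 := by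
  by_contra! hcon
  obtain ⟨hn, hd⟩ := hcon
  have h2 (ω) : 2 * d ω ≤ n := (Nat.mul_le_mul_right _ (he ω)).trans_eq (hed ω)
  have hle : 2 * ∑ ω, d ω ≤ Fintype.card Ω * n := by
    rw [Finset.mul_sum]
    exact (Finset.sum_le_card_nsmul _ _ n fun ω _ => h2 ω).trans (by simp)
  have hlt : Fintype.card Ω < 4 := by
    by_contra! h4
    have := Nat.mul_le_mul_right n h4
    omega
  have f := Fintype.equivFin Ω
  -- Pass to families indexed by `Fin r`.
  generalize hr : Fintype.card Ω = r at *
  rw [← f.symm.sum_comp] at h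
  have hd' (i) := hd (f.symm i)
  have hed' (i) := hed (f.symm i)
  have he' (i) := he (f.symm i)
  generalize hD : (fun i => d (f.symm i)) = D at *
  generalize hE : (fun i => e (f.symm i)) = E at *
  replace hD (i) : d (f.symm i) = D i := congrFun hD i
  replace hE (i) : e (f.symm i) = E i := congrFun hE i
  simp only [hD, hE] at *
  -- The case of three orbits, with the orbit sizes sorted.
  have key (x y z a b c : ℕ) (hx : a * x = n) (hy : b * y = n) (hz : c * z = n) (ha : 2 ≤ a)
      (hb : 2 ≤ b) (hc : 2 ≤ c) (hz3 : 2 < z) (hs : x + y + z = n + 2) (hxy : y ≤ x)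
      (hyz : z ≤ y) : False := by
    have ha' : a < 3 := by
      by_contra! h3
      have := Nat.mul_le_mul_right x h3
      omega
    obtain rfl : a = 2 := by omega
    have hb' : b < 4 := by
      by_contra! h3
      have := Nat.mul_le_mul_right y h3
      omega
    have hc' : c < 6 := by
      by_contra! h3
      have := Nat.mul_le_mul_right z h3
      interval_cases b <;> omega
    interval_cases b <;> interval_cases c <;> omega
  interval_cases r
  · omega
  · simp at h
    omega
  · simp at h
    have := hd' 0
    have := hd' 1
    omega
  · rw [Fin.sum_univ_three] at h
    have k := fun i j l => key (D i) (D j) (D l) (E i) (E j) (E l) (hed' i) (hed' j) (hed' l)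
      (he' i) (he' j) (he' l) (hd' l)
    rcases le_total (D 0) (D 1) with h01 | h01 <;> rcases le_total (D 1) (D 2) with h12 | h12 <;>
      rcases le_total (D 0) (D 2) with h02 | h02
    · exact k 2 1 0 (by omega) h12 h01
    · exact k 2 1 0 (by omega) h12 h01
    · exact k 1 2 0 (by omega) h12 h02
    · exact k 1 0 2 (by omega) h01 h02
    · exact k 2 0 1 (by omega) h02 h01
    · exact k 0 2 1 (by omega) h02 h12
    · exact k 0 1 2 (by omega) h01 h12
    · exact k 0 1 2 (by omega) h01 h12

open MulAction in
theorem card_le_sixty_or_exists_stabilizer_index_le_two {H X : Type*} [Group H] [Finite H]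
    [MulAction H X] (hfix : ∀ h : H, h ≠ 1 → (fixedBy X h).ncard = 2) :
    Nat.card H ≤ 60 ∨ ∃ x : X, (stabilizer H x).index ≤ 2 := by
  classical
  -- The points with nontrivial stabilizer.
  let Y : SubMulAction H X :=
    { carrier := {x | ∃ h : H, h ≠ 1 ∧ h • x = x}
      smul_mem' := by
        rintro g x ⟨h, h1, hx⟩
        exact ⟨g * h * g⁻¹, by simpa using h1, by simp [mul_smul, hx]⟩ }
  have hYmem (x : X) : x ∈ Y ↔ ∃ h : H, h ≠ 1 ∧ h • x = x := Iff.rfl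
  have hY : Finite Y := Set.Finite.to_subtype <|
    (Set.Finite.biUnion (Set.toFinite {h : H | h ≠ 1}) (t := fun h => fixedBy X h) fun h hh =>
      Set.finite_of_ncard_ne_zero (by simp [hfix h hh])) |>.subset fun x hx => by
        simpa using (hYmem x).1 hx
  have := Fintype.ofFinite H
  have := Fintype.ofFinite Y
  have hfixY (h : H) (hh : h ≠ 1) : Fintype.card (fixedBy Y h) = 2 := by
    rw [← hfix h hh, ← Nat.card_eq_fintype_card, ← Nat.card_coe_set_eq]
    refine Nat.card_congr ⟨fun y => ⟨y.1.1, ?_⟩, fun x => ⟨⟨x.1, (hYmem _).2 ⟨h, hh, x.2⟩⟩, ?_⟩,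
      fun y => rfl, fun x => rfl⟩
    · exact congrArg Subtype.val y.2
    · exact Subtype.ext x.2
  have hburn := sum_card_fixedBy_eq_card_orbits_mul_card_group H Y
  rw [← Finset.add_sum_erase _ _ (Finset.mem_univ 1), Finset.sum_congr rfl
    (fun h hh => hfixY h (Finset.ne_of_mem_erase hh))] at hburn
  simp only [Finset.sum_const, Finset.card_erase_of_mem (Finset.mem_univ _), Finset.card_univ,
    fixedBy_one_eq_univ, smul_eq_mul] at hburn
  -- `hburn` now reads `|Y| + 2 (|H| - 1) = r |H|`; split `|Y|` into orbits.
  have hclass := card_eq_sum_card_group_div_card_stabilizer H Y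
  have he (ω : Quotient (orbitRel H Y)) : 2 ≤ Fintype.card (stabilizer H ω.out) := by
    obtain ⟨h, h1, hx⟩ := ω.out.2
    rw [← Nat.card_eq_fintype_card, Nat.succ_le_iff, Subgroup.one_lt_card_iff_ne_bot]
    intro hbot
    exact h1 ((Subgroup.eq_bot_iff_forall _).1 hbot h (Subtype.ext hx))
  have hed (ω : Quotient (orbitRel H Y)) : Fintype.card (stabilizer H ω.out) *
      (Fintype.card H / Fintype.card (stabilizer H ω.out)) = Fintype.card H := by
    rw [Nat.mul_div_cancel']
    simpa using Subgroup.card_subgroup_dvd_card (stabilizer H ω.out)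
  have hpos : 0 < Fintype.card H := Fintype.card_pos
  rcases le_sixty_or_exists_le_two (Fintype.card H)
    (fun ω : Quotient (orbitRel H Y) => Fintype.card H / Fintype.card (stabilizer H ω.out)) _
    hed he (by rw [← hclass, ← hburn]; simp; omega) with h | ⟨ω, h⟩
  · exact Or.inl (by simpa using h)
  · refine Or.inr ⟨ω.out.1, ?_⟩
    have hs : stabilizer H (ω.out : X) = stabilizer H ω.out := by
      ext
      simp [Subtype.ext_iff]
    rw [hs, ← Nat.mul_div_cancel_left (stabilizer H ω.out).index
      (Nat.card_pos (α := stabilizer H ω.out)),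
      Subgroup.card_mul_index]
    simpa using h

/-! ### Bounds for the Jordan constant of a finite group -/

open scoped Nat in
theorem Subgroup.index_normalCore_le_factorial {G : Type*} [Group G] (A : Subgroup G)
    [A.FiniteIndex] : A.normalCore.index ≤ (A.index)! := by
  rw [Subgroup.normalCore_eq_ker, Subgroup.index_ker, Subgroup.index, ← Nat.card_perm]
  exact Subgroup.card_le_card_group (MulAction.toPermHom G (G ⧸ A)).range

theorem finiteJordanConstant_le_factorial_index {G : Type*} [Group G] [Finite G]
    (A : Subgroup G) [IsMulCommutative A] : finiteJordanConstant G ≤ Nat.factorial A.index := by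
  refine le_trans (Nat.sInf_le ⟨A.normalCore, inferInstance, ?_, rfl⟩)
    A.index_normalCore_le_factorial
  exact ⟨⟨fun a b => Subtype.ext <| setLike_mul_comm (A.normalCore_le a.2) (A.normalCore_le b.2)⟩⟩

theorem finiteJordanConstant_le_card {G : Type*} [Group G] [Finite G] :
    finiteJordanConstant G ≤ Nat.card G :=
  Nat.sInf_le ⟨⊥, inferInstance, inferInstance, Subgroup.index_bot⟩

/-! ### Finite subgroups of `PGL₂` in characteristic zero -/

theorem mk_eq_one_iff {F : Type*} [Field F] {g : GL (Fin 2) F} :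
    ProjGenLinGroup.mk g = 1 ↔ g.val ∈ Set.range (Matrix.scalar (Fin 2)) := by
  rw [ProjGenLinGroup.mk_eq_one, mem_center_iff_val_mem_range_scalar]

/-- In characteristic zero, parabolic elements of `PGL₂` have infinite order. -/
theorem discr_ne_zero_of_isOfFinOrder {F : Type*} [Field F] [CharZero F] {g : GL (Fin 2) F}
    (hg1 : ProjGenLinGroup.mk g ≠ 1) (hg : IsOfFinOrder (ProjGenLinGroup.mk g)) :
    g.val.discr ≠ 0 := by
  intro h0
  obtain ⟨n, hn, hgn⟩ := isOfFinOrder_iff_pow_eq_one.1 hg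
  have hp : g.IsParabolic := ⟨fun h => hg1 (mk_eq_one_iff.2 h), h0⟩
  rw [← map_pow, mk_eq_one_iff] at hgn
  exact (hp.pow hn.ne').1 hgn

section
open OnePoint
variable {F : Type*} [Field F] [DecidableEq F]

theorem scalar_smul_onePoint (u : Fˣ) (x : OnePoint F) :
    GeneralLinearGroup.scalar (Fin 2) u • x = x := by
  cases x with
  | infty => simp [smul_infty_eq_ite]
  | coe x => simp [smul_some_eq_ite]

theorem ncard_fixedBy_onePoint [IsAlgClosed F] [NeZero (2 : F)] {g : GL (Fin 2) F}
    (hg : g.val.discr ≠ 0) : (MulAction.fixedBy (OnePoint F) g).ncard = 2 := by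
  rw [Set.ncard_eq_two]
  rw [discr_fin_two, trace_fin_two, det_fin_two] at hg
  by_cases hc : g 1 0 = 0
  · have hd : g 1 1 - g 0 0 ≠ 0 := by
      intro h
      apply hg
      rw [sub_eq_zero.1 h, hc]
      ring
    refine ⟨∞, ((g 0 1 / (g 1 1 - g 0 0) : F) : OnePoint F), infty_ne_coe _, ?_⟩
    ext x
    cases x with
    | infty => simp [smul_infty_eq_self_iff, hc]
    | coe x =>
      rw [MulAction.mem_fixedBy, ← fixpointPolynomial_aeval_eq_zero_iff]
      simp [fixpointPolynomial, hc, sub_eq_zero, eq_div_iff hd, mul_comm]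
  · obtain ⟨r, hr⟩ := IsAlgClosed.exists_eq_mul_self
      (discrim (g 1 0) (g 1 1 - g 0 0) (-g 0 1))
    have hr0 : r ≠ 0 := by
      rintro rfl
      apply hg
      rw [discrim] at hr
      linear_combination hr
    refine ⟨(((-(g 1 1 - g 0 0) + r) / (2 * g 1 0) : F) : OnePoint F),
      (((-(g 1 1 - g 0 0) - r) / (2 * g 1 0) : F) : OnePoint F), ?_, ?_⟩
    · rw [Ne, OnePoint.coe_eq_coe, div_left_inj' (mul_ne_zero two_ne_zero hc)]
      intro h
      have : 2 * r = 0 := by linear_combination h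
      exact hr0 ((mul_eq_zero.1 this).resolve_left two_ne_zero)
    · ext x
      cases x with
      | infty => simp [smul_infty_eq_self_iff, hc]
      | coe x =>
        rw [MulAction.mem_fixedBy, ← fixpointPolynomial_aeval_eq_zero_iff]
        simpa [fixpointPolynomial, sq, sub_eq_add_neg] using quadratic_eq_zero_iff hc hr x

/-- The commutator of two matrices with a common eigenvector has determinant `1` and trace `2`. -/
theorem discr_commutator_eq_zero {a b : GL (Fin 2) F} {x : OnePoint F} (ha : a • x = x)
    (hb : b • x = x) : (a * b * a⁻¹ * b⁻¹).val.discr = 0 := by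
  have hinv (g : GL (Fin 2) F) : (g⁻¹).val = (g.val.det)⁻¹ • g.val.adjugate := by
    rw [coe_units_inv, Matrix.inv_def, Ring.inverse_eq_inv']
  have htr : (a * b * a⁻¹ * b⁻¹).val.trace = 2 := by
    have hda := a.det_ne_zero
    have hdb := b.det_ne_zero
    simp only [Units.val_mul, hinv, Matrix.mul_smul, Matrix.smul_mul, trace_smul, smul_eq_mul]
    rw [← mul_assoc, ← mul_inv, inv_mul_eq_iff_eq_mul₀ (mul_ne_zero hdb hda)]
    simp only [adjugate_fin_two, trace_fin_two, Matrix.mul_apply, Fin.sum_univ_two, det_fin_two]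
    simp
    -- Fixing `x` is an equation between the matrix entries, which eliminates one of them.
    cases x with
    | infty =>
      rw [smul_infty_eq_self_iff] at ha hb
      rw [ha, hb]
      ring
    | coe x =>
      rw [← fixpointPolynomial_aeval_eq_zero_iff] at ha hb
      simp [fixpointPolynomial] at ha hb
      rw [← sub_eq_zero.1 ha, ← sub_eq_zero.1 hb]
      ring
  rw [discr_fin_two, htr, ← GeneralLinearGroup.val_det_apply]
  simp
  norm_num

end

/-- What the upper bound needs of the classification of finite subgroups of `PGL₂` over an
algebraically closed field of characteristic zero. -/
theorem card_le_sixty_or_exists_isMulCommutative_of_pgl {F : Type*} [Field F] [IsAlgClosed F]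
    [CharZero F] {H : Type*} [Group H] [Finite H] (φ : H →* PGL(2, F)) (hφ : Function.Injective φ) :
    Nat.card H ≤ 60 ∨ ∃ A : Subgroup H, IsMulCommutative A ∧ A.index ≤ 2 := by
  classical
  let _ : MulAction PGL(2, F) (OnePoint F) :=
    ProjGenLinGroup.mulActionOfGL scalar_smul_onePoint
  let _ : MulAction H (OnePoint F) := MulAction.compHom _ φ
  have hsmul (h : H) (g : GL (Fin 2) F) (hg : ProjGenLinGroup.mk g = φ h) (x : OnePoint F) :
      h • x = g • x := by
    change φ h • x = g • x
    rw [← hg]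
    rfl
  have hdiscr (h : H) (g : GL (Fin 2) F) (hg : ProjGenLinGroup.mk g = φ h) (h1 : h ≠ 1) :
      g.val.discr ≠ 0 := by
    refine discr_ne_zero_of_isOfFinOrder ?_ ?_
    · rw [hg]
      exact (map_ne_one_iff φ hφ).2 h1
    · rw [hg]
      exact φ.isOfFinOrder (isOfFinOrder_of_finite h)
  refine (card_le_sixty_or_exists_stabilizer_index_le_two (X := OnePoint F)
    fun h h1 => ?_).imp_right fun ⟨x, hx⟩ => ⟨MulAction.stabilizer H x, ?_, hx⟩
  · obtain ⟨g, hg⟩ := ProjGenLinGroup.mk_surjective (φ h)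
    rw [← ncard_fixedBy_onePoint (hdiscr h g hg h1)]
    congr 1
    ext x
    simp [hsmul h g hg]
  · refine .of_setLike_mul_comm fun h hh k hk => ?_
    obtain ⟨a, ha⟩ := ProjGenLinGroup.mk_surjective (φ h)
    obtain ⟨b, hb⟩ := ProjGenLinGroup.mk_surjective (φ k)
    -- A nontrivial commutator would be parabolic, although it has finite order.
    by_contra hne
    refine hdiscr (h * k * h⁻¹ * k⁻¹) (a * b * a⁻¹ * b⁻¹) (by simp [ha, hb]) ?_
      (discr_commutator_eq_zero (x := x) ?_ ?_)
    · rw [Ne, mul_inv_eq_one, mul_inv_eq_iff_eq_mul]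
      exact hne
    · rw [← hsmul h a ha]
      exact hh
    · rw [← hsmul k b hb]
      exact hk

theorem pglMap_injective {L F : Type*} [Field L] [Field F] (f : L →+* F) :
    Function.Injective (pglMap f) := by
  rw [injective_iff_map_eq_one]
  intro x hx
  obtain ⟨g, rfl⟩ := ProjGenLinGroup.mk_surjective x
  rw [pglMap_mk, ProjGenLinGroup.mk_eq_one, mem_center_iff_val_mem_range_scalar] at hx
  rw [ProjGenLinGroup.mk_eq_one, mem_center_iff_val_mem_range_scalar]
  obtain ⟨r, hr⟩ := hx
  have h (i j) := congrFun (congrFun hr i) j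
  simp only [scalar_apply, diagonal_apply] at h
  refine ⟨g 0 0, ?_⟩
  ext i j
  have h00 := h 0 0
  apply f.injective
  have := h i j
  fin_cases i <;> fin_cases j <;> simp_all

theorem finiteJordanConstant_le_of_semidirectProduct_pgl {L : Type*} [Field L] [CharZero L]
    (φ : Multiplicative (ZMod 2) →* MulAut PGL(2, L))
    (G : Subgroup (PGL(2, L) ⋊[φ] Multiplicative (ZMod 2))) [Finite G] :
    finiteJordanConstant G ≤ 120 := by
  let π : G →* Multiplicative (ZMod 2) := SemidirectProduct.rightHom.comp G.subtype
  have hker (g : π.ker) : g.1.1.right = 1 := g.2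
  let ψ : π.ker →* PGL(2, L) :=
    { toFun := fun g => g.1.1.left
      map_one' := rfl
      map_mul' := fun g h => by simp [hker] }
  have hψ : Function.Injective ψ := fun g h hgh =>
    Subtype.ext <| Subtype.ext <| SemidirectProduct.ext hgh ((hker g).trans (hker h).symm)
  have hind : π.ker.index ≤ 2 := by
    rw [Subgroup.index_ker]
    exact (Subgroup.card_le_card_group π.range).trans_eq (by simp [Nat.card_eq_fintype_card])
  rcases card_le_sixty_or_exists_isMulCommutative_of_pgl
      ((pglMap (algebraMap L (AlgebraicClosure L))).comp ψ)
      ((pglMap_injective _).comp hψ) with h | ⟨A, hA, h⟩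
  · refine finiteJordanConstant_le_card.trans ?_
    rw [← π.ker.card_mul_index]
    exact Nat.mul_le_mul h hind
  · -- `A` has index at most `4` in `G`, and its normal core index at most `4!`.
    have hA4 : (A.map π.ker.subtype).index ≤ 4 := by
      rw [Subgroup.index_map_subtype]
      exact Nat.mul_le_mul h hind
    calc _ ≤ Nat.factorial _ := finiteJordanConstant_le_factorial_index (A.map π.ker.subtype)
      _ ≤ Nat.factorial 4 := Nat.factorial_le hA4
      _ ≤ 120 := by decide

/-! ### Embedding a symmetric group -/

theorem Equiv.Perm.eq_bot_of_normal_isMulCommutative {α : Type*} [DecidableEq α] [Fintype α]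
    (hα : 5 ≤ Nat.card α) (A : Subgroup (Equiv.Perm α)) [A.Normal] [IsMulCommutative A] :
    A = ⊥ := by
  by_contra hA
  have hle := Equiv.Perm.alternatingGroup_le_of_normal hα (Subgroup.nontrivial_iff_ne_bot A |>.2 hA)
  have hcomm : IsMulCommutative (alternatingGroup α) :=
    .of_setLike_mul_comm fun a ha b hb => setLike_mul_comm (hle ha) (hle hb)
  have hc := alternatingGroup.center_eq_bot (α := α) (by omega)
  rw [Subgroup.eq_bot_iff_forall] at hc
  have := alternatingGroup.nontrivial_of_three_le_card (α := α)
    (by simpa using hα.trans' (by omega))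
  obtain ⟨g, hg⟩ := exists_ne (1 : alternatingGroup α)
  exact hg (hc g (Subgroup.mem_center_iff.2 fun h => mul_comm' h g))

theorem factorial_le_jordanConstant {Γ : Type*} [Group Γ] {n : ℕ} (hn : 5 ≤ n)
    (f : Equiv.Perm (Fin n) →* Γ) (hf : Function.Injective f) :
    (n.factorial : ℕ∞) ≤ jordanConstant Γ := by
  have : Finite f.range := Set.finite_range f
  refine le_trans ?_ (le_iSup₂_of_le f.range this le_rfl)
  rw [Nat.cast_le]
  refine le_csInf ⟨_, ⊥, inferInstance, inferInstance, rfl⟩ ?_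
  rintro _ ⟨A, hA, hAc, rfl⟩
  have hcomm : IsMulCommutative (A.comap f.rangeRestrict) :=
    .of_setLike_mul_comm fun a ha b hb => hf <| by
      simpa using congrArg Subtype.val (setLike_mul_comm (s := A) ha hb)
  have hbot := Equiv.Perm.eq_bot_of_normal_isMulCommutative (by simpa) (A.comap f.rangeRestrict)
  rw [← A.index_comap_of_surjective f.rangeRestrict_surjective, hbot, Subgroup.index_bot,
    Nat.card_perm, Nat.card_fin]

/-- If a family `r` of distinct elements of `Γ` has trivial common centralizer, and each
transposition of the index set is induced on `r` by conjugation with an element of `Γ`, then each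
permutation is induced by exactly one element of `Γ`, and this is an embedding of the symmetric
group. -/
theorem exists_injective_perm_hom {Γ α : Type*} [Group Γ] [DecidableEq α] [Finite α] (r : α → Γ)
    (hr : Function.Injective r) (hcent : ∀ γ, (∀ a, γ * r a = r a * γ) → γ = 1)
    (hswap : ∀ a b, a ≠ b → ∃ γ, ∀ e, γ * r e = r (Equiv.swap a b e) * γ) :
    ∃ f : Equiv.Perm α →* Γ, Function.Injective f := by
  have hex (π : Equiv.Perm α) : ∃ γ, ∀ e, γ * r e = r (π e) * γ := by
    induction π using Equiv.Perm.swap_induction_on with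
    | one => exact ⟨1, by simp⟩
    | swap_mul π a b hab ih =>
      obtain ⟨γ, hγ⟩ := ih
      obtain ⟨δ, hδ⟩ := hswap a b hab
      exact ⟨δ * γ, fun e => by rw [mul_assoc, hγ, ← mul_assoc, hδ, mul_assoc]; rfl⟩
  choose f hf using hex
  have huniq (π : Equiv.Perm α) (γ : Γ) (hγ : ∀ e, γ * r e = r (π e) * γ) : γ = f π := by
    rw [← inv_mul_eq_one]
    refine hcent _ fun e => ?_
    have h : γ⁻¹ * r (π e) = r e * γ⁻¹ := by
      rw [inv_mul_eq_iff_eq_mul, ← mul_assoc, hγ, mul_inv_cancel_right]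
    rw [mul_assoc, hf, ← mul_assoc, h, mul_assoc]
  refine ⟨⟨⟨f, (huniq 1 1 (by simp)).symm⟩, fun π ρ => (huniq _ _ fun e => ?_).symm⟩, ?_⟩
  · rw [mul_assoc, hf, ← mul_assoc, hf, mul_assoc]
    rfl
  · rw [injective_iff_map_eq_one]
    intro π hπ
    ext e
    refine hr ?_
    have := hf π e
    rw [show f π = 1 from hπ] at this
    simpa using this.symm

/-! ### Two-by-two matrices up to scalars -/

theorem mk_eq_mk_iff_val_eq_smul {L : Type*} [Field L] {g h : GL (Fin 2) L} :
    ProjGenLinGroup.mk g = ProjGenLinGroup.mk h ↔ ∃ r : L, h.val = r • g.val := by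
  have hmul (u : Lˣ) : (g * GeneralLinearGroup.scalar (Fin 2) u).val = u.val • g.val := by
    rw [Units.val_mul, coe_scalar, scalar_apply, ← smul_eq_mul_diagonal]
  rw [ProjGenLinGroup.mk_eq_mk_iff]
  constructor
  · rintro ⟨u, rfl⟩
    exact ⟨u, hmul u⟩
  · rintro ⟨r, hr⟩
    have hr0 : r ≠ 0 := by
      rintro rfl
      exact h.ne_zero (by rw [hr, zero_smul])
    exact ⟨Units.mk0 r hr0, Units.ext ((hmul _).trans hr.symm)⟩

/-- A relation `g a g⁻¹ = b` in `PGL₂` lifts to matrices when `a` and `b` have the same nonzero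
trace. -/
theorem mul_eq_mul_of_mk_eq_mk {L : Type*} [Field L] {g a b : GL (Fin 2) L}
    (h : ProjGenLinGroup.mk (g * a) = ProjGenLinGroup.mk (b * g)) (hab : a.val.trace = b.val.trace)
    (ha : a.val.trace ≠ 0) : g.val * a.val = b.val * g.val := by
  obtain ⟨u, hu⟩ := mk_eq_mk_iff_val_eq_smul.1 h
  rw [Units.val_mul, Units.val_mul] at hu
  have htr : b.val.trace = u * a.val.trace := by
    rw [← trace_units_conj g a.val, ← smul_eq_mul, ← trace_smul, ← smul_mul, ← hu,
      Matrix.mul_assoc, Units.mul_inv, Matrix.mul_one]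
  rw [hu, mul_right_cancel₀ ha ((one_mul _).trans (hab.trans htr)).symm, one_smul]

/-- With `M ↦ M.det` as quadratic form, the polar form is `(A, B) ↦ (A * B.adjugate).trace`; the
identity says that `B ↦ A * B.adjugate * A` is, up to the factor `-A.det`, the reflection in `A`. -/
theorem mul_adjugate_mul {R : Type*} [CommRing R] (A B : Matrix (Fin 2) (Fin 2) R) :
    A * B.adjugate * A = (A * B.adjugate).trace • A - A.det • B := by
  ext i j
  fin_cases i <;> fin_cases j <;>
    simp [adjugate_fin_two, Matrix.mul_apply, trace_fin_two, det_fin_two] <;> ring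

theorem det_sub_fin_two {R : Type*} [CommRing R] (A B : Matrix (Fin 2) (Fin 2) R) :
    (A - B).det = A.det + B.det - (A * B.adjugate).trace := by
  simp [adjugate_fin_two, Matrix.mul_apply, trace_fin_two, det_fin_two]
  ring

/-! ### Simplices of matrices -/

/-- A regular simplex of matrices gives an embedding of `S₅`. The vertices `V a` have determinant
`1` and polar products `-1 / 2`, one of them is the identity, and the twisted involution
`M ↦ C * σ M * C⁻¹` acts on them as the adjugate. The hypotheses `hcomm` and `hanti`, which hold
when the vertices span the matrix algebra, make the common centralizer of the five involutions of
the semidirect product attached to the vertices trivial. -/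
theorem exists_injective_perm_five_hom {L : Type*} [Field L] [CharZero L] (σ : L →+* L)
    (φ : Multiplicative (ZMod 2) →* MulAut PGL(2, L))
    (hφ : ∀ g : GL (Fin 2) L,
      φ (Multiplicative.ofAdd 1) (ProjGenLinGroup.mk g) = ProjGenLinGroup.mk (g.map σ))
    (C : GL (Fin 2) L) (hC : ProjGenLinGroup.mk (C * C.map σ) = 1)
    (V : Fin 5 → Matrix (Fin 2) (Fin 2) L) (hV : ∀ a, (V a).det = 1)
    (hVV : ∀ a b, a ≠ b → (V a * (V b).adjugate).trace = -1 / 2)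
    (hCV : ∀ a, C.val * (V a).map σ = (V a).adjugate * C.val)
    (hV0 : V 0 = 1)
    (hcomm : ∀ g, (∀ a, g * V a = V a * g) → g ∈ Set.range (Matrix.scalar (Fin 2)))
    (hanti : ∀ g, (∀ a, g * (V a).adjugate = V a * g) → g = 0) :
    ∃ f : Equiv.Perm (Fin 5) →* PGL(2, L) ⋊[φ] Multiplicative (ZMod 2), Function.Injective f := by
  -- `κ` is the twisted involution as an element of the semidirect product.
  let κ : PGL(2, L) ⋊[φ] Multiplicative (ZMod 2) :=
    ⟨ProjGenLinGroup.mk C, Multiplicative.ofAdd 1⟩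
  let X (g : GL (Fin 2) L) : PGL(2, L) ⋊[φ] Multiplicative (ZMod 2) :=
    SemidirectProduct.inl (ProjGenLinGroup.mk g)
  have hXmul (g h : GL (Fin 2) L) : X (g * h) = X g * X h := by simp [X]
  have hXinv (g : GL (Fin 2) L) : X g⁻¹ = (X g)⁻¹ := by simp [X]
  have hX {g h : GL (Fin 2) L} : X g = X h ↔ ProjGenLinGroup.mk g = ProjGenLinGroup.mk h :=
    SemidirectProduct.inl_inj
  have hκκ : κ * κ = 1 := by
    refine SemidirectProduct.ext ?_ (by simp [κ, ← ofAdd_add]; rfl)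
    rw [SemidirectProduct.mul_left, hφ, ← map_mul]
    exact hC
  have hκX (W : GL (Fin 2) L) (hW : C.val * W.val.map σ = W.val.adjugate * C.val) :
      κ * X W = (X W)⁻¹ * κ := by
    rw [eq_inv_mul_iff_mul_eq]
    refine SemidirectProduct.ext ?_ (by simp [κ, X])
    simp only [X, κ, SemidirectProduct.mul_left, SemidirectProduct.left_inl,
      SemidirectProduct.right_inl, map_one, MulAut.one_apply, hφ, ← map_mul]
    refine (mk_eq_mk_iff_val_eq_smul.2 ⟨W.val.det, ?_⟩).symm
    simp only [Units.val_mul]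
    rw [show (W.map σ).val = W.val.map σ from rfl, hW, ← Matrix.mul_assoc, mul_adjugate, smul_mul,
      Matrix.one_mul]
  let v (a : Fin 5) : GL (Fin 2) L := GeneralLinearGroup.mkOfDetNeZero (V a) (by simp [hV])
  have hv (a) : (v a).val = V a := rfl
  have hvinv (a) : (v a)⁻¹.val = (V a).adjugate := by
    rw [coe_units_inv, Matrix.inv_def, hv, hV, Ring.inverse_one, one_smul]
  have hκv (a) : κ * X (v a) = (X (v a))⁻¹ * κ := hκX (v a) (hCV a)
  have hv0 : v 0 = 1 := Units.ext hV0
  have htr (a) : (V a).trace ≠ 0 := by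
    by_cases h : a = 0
    · simp [h, hV0]
    · have := hVV a 0 h
      rw [hV0, adjugate_one, Matrix.mul_one] at this
      rw [this]
      norm_num
  have hvv (a b) : (V a * (V b).adjugate).trace = if a = b then 2 else -1 / 2 := by
    split_ifs with h
    · simp [h, mul_adjugate, hV]
    · exact hVV a b h
  have hdet (a b) (hab : a ≠ b) : (V a - V b).det = 5 / 2 := by
    rw [det_sub_fin_two, hV, hV, hVV a b hab]
    norm_num
  refine exists_injective_perm_hom (fun a => X (v a) * κ) ?_ ?_ ?_
  · -- If `V b = u • V a` with `a ≠ b`, then `u ^ 2 = 1` and `2 * u = -1 / 2`.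
    intro a b hab
    by_contra hne
    obtain ⟨u, hu⟩ := mk_eq_mk_iff_val_eq_smul.1 (hX.1 (mul_right_cancel hab))
    rw [hv, hv] at hu
    have h1 : u * 2 = -1 / 2 := by
      rw [← hVV b a (Ne.symm hne), hu, smul_mul, trace_smul, hvv, if_pos rfl, smul_eq_mul]
    have h2 : u ^ 2 = 1 := by
      rw [← hV b, hu, det_smul, hV]
      simp
    have : (15 : L) = 0 := by linear_combination 8 * (u - 1 / 4) * h1 - 16 * h2
    norm_num at this
  · -- As `V 0 = 1`, an element centralizing the family commutes with `κ` and with all `X (v a)`.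
    intro γ hγ
    have hγκ : γ * κ = κ * γ := by simpa [hv0, X] using hγ 0
    have hγX (a) : γ * X (v a) = X (v a) * γ := by
      have := hγ a
      rw [mul_assoc, ← hγκ, ← mul_assoc, ← mul_assoc] at this
      exact mul_right_cancel this
    have hcases (t : Multiplicative (ZMod 2)) : t = 1 ∨ t = Multiplicative.ofAdd 1 := by
      revert t
      decide
    rcases hcases γ.right with ht | ht
    · obtain ⟨g, hg⟩ := ProjGenLinGroup.mk_surjective γ.left
      have hγg : γ = X g := SemidirectProduct.ext (by simp [X, hg]) (by simp [X, ht])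
      simp only [hγg, ← hXmul, hX] at hγX
      rw [hγg, show (1 : PGL(2, L) ⋊[φ] Multiplicative (ZMod 2)) = X 1 by simp [X], hX, map_one,
        mk_eq_one_iff]
      exact hcomm _ fun a => mul_eq_mul_of_mk_eq_mk (hγX a) rfl (htr a)
    · obtain ⟨g, hg⟩ := ProjGenLinGroup.mk_surjective (γ.left * (ProjGenLinGroup.mk C)⁻¹)
      have hγg : γ = X g * κ :=
        SemidirectProduct.ext (by simp [X, κ, hg]) (by simp [X, κ, ht])
      have hγX' (a) : ProjGenLinGroup.mk (g * (v a)⁻¹) = ProjGenLinGroup.mk (v a * g) := by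
        have := hγX a
        rw [hγg, mul_assoc, hκv, ← mul_assoc, ← mul_assoc, ← hXinv, ← hXmul, ← hXmul] at this
        exact hX.1 (mul_right_cancel this)
      -- Conjugation by `g` would send the conjugate of each vertex to the vertex.
      refine absurd (hanti g.val fun a => ?_) g.ne_zero
      rw [← hvinv]
      refine mul_eq_mul_of_mk_eq_mk (hγX' a) ?_ ?_
      · rw [hvinv, hv, adjugate_fin_two, trace_fin_two, trace_fin_two]
        simp [add_comm]
      · rw [hvinv, adjugate_fin_two]
        simpa [trace_fin_two, add_comm] using htr a
  · -- The transposition `(a b)` is the reflection in `V a - V b`.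
    intro a b hab
    let w : GL (Fin 2) L := GeneralLinearGroup.mkOfDetNeZero (V a - V b)
      (by rw [hdet a b hab]; norm_num)
    have hw : w.val = V a - V b := rfl
    have hκw : κ * X w = (X w)⁻¹ * κ := by
      refine hκX w ?_
      have hadj : (V a - V b).adjugate = (V a).adjugate - (V b).adjugate := by
        simp only [adjugate_fin_two]
        ext i j
        fin_cases i <;> fin_cases j <;> simp <;> ring
      have hmap : (V a - V b).map σ = (V a).map σ - (V b).map σ := by
        ext i j
        simp
      rw [hw, hadj, hmap, Matrix.mul_sub, Matrix.sub_mul, hCV, hCV]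
    refine ⟨X w * κ, fun e => ?_⟩
    have hmain : X w * (X (v e))⁻¹ * X w = X (v (Equiv.swap a b e)) := by
      rw [← hXinv, ← hXmul, ← hXmul, hX]
      refine (mk_eq_mk_iff_val_eq_smul.2 ⟨-5 / 2, ?_⟩).symm
      rw [Units.val_mul, Units.val_mul, hvinv, hw, mul_adjugate_mul, hdet a b hab, Matrix.sub_mul,
        trace_sub, hvv, hvv, hv]
      rcases eq_or_ne e a with rfl | hea
      · rw [if_pos rfl, if_neg hab.symm, Equiv.swap_apply_left]
        module
      rcases eq_or_ne e b with rfl | heb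
      · rw [if_pos rfl, if_neg hab, Equiv.swap_apply_right]
        module
      · rw [if_neg hea.symm, if_neg heb.symm, Equiv.swap_apply_of_ne_of_ne hea heb]
        module
    calc X w * κ * (X (v e) * κ) = X w * (κ * X (v e)) * κ := by simp only [mul_assoc]
      _ = X w * (X (v e))⁻¹ * (κ * κ) := by rw [hκv]; simp only [mul_assoc]
      _ = X w * (X (v e))⁻¹ * X w * (X w)⁻¹ * (κ * κ) := by rw [mul_inv_cancel_right]
      _ = X (v (Equiv.swap a b e)) * ((X w)⁻¹ * κ) * κ := by rw [hmain]; simp only [mul_assoc]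
      _ = X (v (Equiv.swap a b e)) * κ * (X w * κ) := by rw [← hκw]; simp only [mul_assoc]

/-! ### Quaternions in the matrix algebra -/

/-- Let `i = !![0, -1; 1, 0]` and `j = !![x, y; y, -x]`. The matrix `C = p + q * i` satisfies
`C * σ j = j * C`, by the last two equations, and `C * σ C` is the scalar `p ^ 2 + q ^ 2`. -/
theorem exists_quaternion_descent {L : Type*} [Field L] [CharZero L] (σ : L →+* L)
    (hσ : ∀ z, σ (σ z) = z) (x y : L) (h : x ^ 2 + y ^ 2 = -1) :
    ∃ p q : L, p ^ 2 + q ^ 2 ≠ 0 ∧ σ p = p ∧ σ q = -q ∧ p * (σ x - x) = q * (y + σ y) ∧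
      p * (σ y - y) = -q * (x + σ x) := by
  have h' : (σ x) ^ 2 + (σ y) ^ 2 = -1 := by simpa using congrArg σ h
  -- The equations have two solutions whose values of `p ^ 2 + q ^ 2` add up to `-4`.
  by_cases h0 : (x + σ x) ^ 2 + (y - σ y) ^ 2 = 0
  · refine ⟨y + σ y, σ x - x, fun h1 => ?_, by simp [hσ, add_comm], by simp [hσ], by ring, ?_⟩
    · have : (4 : L) = 0 := by linear_combination -h0 - h1 + 2 * h + 2 * h'
      norm_num at this
    · linear_combination h' - h
  · refine ⟨x + σ x, y - σ y, h0, by simp [hσ, add_comm], by simp [hσ], ?_, by ring⟩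
    linear_combination h' - h

/-- The matrix `q₀ + q₁ i + q₂ j + q₃ i j`, where `i = !![0, -1; 1, 0]` and `j = !![x, y; y, -x]`.
When `x ^ 2 + y ^ 2 = -1`, these satisfy `i ^ 2 = j ^ 2 = -1` and `i j = -j i`. -/
def quaternionMatrix {L : Type*} [Field L] (x y q₀ q₁ q₂ q₃ : L) : Matrix (Fin 2) (Fin 2) L :=
  !![q₀ + x * q₂ - y * q₃, -q₁ + y * q₂ + x * q₃; q₁ + y * q₂ + x * q₃, q₀ - x * q₂ + y * q₃]

section
variable {L : Type*} [Field L] {x y : L}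

theorem adjugate_quaternionMatrix (q₀ q₁ q₂ q₃ : L) :
    (quaternionMatrix x y q₀ q₁ q₂ q₃).adjugate =
      quaternionMatrix x y q₀ (-q₁) (-q₂) (-q₃) := by
  ext i j
  fin_cases i <;> fin_cases j <;> simp [quaternionMatrix, adjugate_fin_two] <;> ring

theorem det_quaternionMatrix (hxy : x ^ 2 + y ^ 2 = -1) (q₀ q₁ q₂ q₃ : L) :
    (quaternionMatrix x y q₀ q₁ q₂ q₃).det = q₀ ^ 2 + q₁ ^ 2 + q₂ ^ 2 + q₃ ^ 2 := by
  simp only [quaternionMatrix, det_fin_two_of]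
  linear_combination -(q₂ ^ 2 + q₃ ^ 2) * hxy

theorem trace_quaternionMatrix_mul_adjugate (hxy : x ^ 2 + y ^ 2 = -1)
    (q₀ q₁ q₂ q₃ r₀ r₁ r₂ r₃ : L) :
    (quaternionMatrix x y q₀ q₁ q₂ q₃ * (quaternionMatrix x y r₀ r₁ r₂ r₃).adjugate).trace =
      2 * (q₀ * r₀ + q₁ * r₁ + q₂ * r₂ + q₃ * r₃) := by
  rw [adjugate_quaternionMatrix]
  simp only [quaternionMatrix, mul_fin_two, trace_fin_two_of]
  linear_combination -2 * (q₂ * r₂ + q₃ * r₃) * hxy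

theorem quaternionMatrix_add (q₀ q₁ q₂ q₃ r₀ r₁ r₂ r₃ : L) :
    quaternionMatrix x y q₀ q₁ q₂ q₃ + quaternionMatrix x y r₀ r₁ r₂ r₃ =
      quaternionMatrix x y (q₀ + r₀) (q₁ + r₁) (q₂ + r₂) (q₃ + r₃) := by
  ext i j
  fin_cases i <;> fin_cases j <;> simp [quaternionMatrix] <;> ring

theorem smul_quaternionMatrix (t q₀ q₁ q₂ q₃ : L) :
    t • quaternionMatrix x y q₀ q₁ q₂ q₃ =
      quaternionMatrix x y (t * q₀) (t * q₁) (t * q₂) (t * q₃) := by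
  ext i j
  fin_cases i <;> fin_cases j <;> simp [quaternionMatrix] <;> ring

theorem mem_range_scalar_of_commute_quaternionMatrix [NeZero (2 : L)] (hxy : x ^ 2 + y ^ 2 = -1)
    {g : Matrix (Fin 2) (Fin 2) L}
    (hi : g * quaternionMatrix x y 0 1 0 0 = quaternionMatrix x y 0 1 0 0 * g)
    (hj : g * quaternionMatrix x y 0 0 1 0 = quaternionMatrix x y 0 0 1 0 * g) :
    g ∈ Set.range (Matrix.scalar (Fin 2)) := by
  have i₀ := congrFun₂ hi 0 0
  have i₁ := congrFun₂ hi 0 1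
  have j₀ := congrFun₂ hj 0 0
  have j₁ := congrFun₂ hj 0 1
  simp [quaternionMatrix, Matrix.mul_apply] at i₀ i₁ j₀ j₁
  have hb : g 0 1 = 0 := by
    refine (mul_eq_zero.1 (?_ : 2 * g 0 1 = 0)).resolve_left two_ne_zero
    linear_combination -y * j₀ - y ^ 2 * i₀ + x * j₁ - x * y * i₁ + 2 * g 0 1 * hxy
  refine ⟨g 0 0, ?_⟩
  ext i j
  fin_cases i <;> fin_cases j <;> simp
  · exact hb.symm
  · linear_combination hb - i₀
  · linear_combination i₁

theorem eq_zero_of_anticommute_quaternionMatrix [NeZero (2 : L)] (hxy : x ^ 2 + y ^ 2 = -1)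
    {g : Matrix (Fin 2) (Fin 2) L}
    (hi : g * quaternionMatrix x y 0 (-1) 0 0 = quaternionMatrix x y 0 1 0 0 * g)
    (hj : g * quaternionMatrix x y 0 0 (-1) 0 = quaternionMatrix x y 0 0 1 0 * g)
    (hk : g * quaternionMatrix x y 0 0 0 (-1) = quaternionMatrix x y 0 0 0 1 * g) :
    g = 0 := by
  have i₀ := congrFun₂ hi 0 0
  have i₁ := congrFun₂ hi 0 1
  have j₀ := congrFun₂ hj 0 0
  have k₀ := congrFun₂ hk 0 0
  simp [quaternionMatrix, Matrix.mul_apply] at i₀ i₁ j₀ k₀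
  have ha : g 0 0 = 0 := by
    refine (mul_eq_zero.1 (?_ : 2 * g 0 0 = 0)).resolve_left two_ne_zero
    linear_combination x * j₀ - y * k₀ + 2 * g 0 0 * hxy
  have hb : g 0 1 = 0 := by
    refine (mul_eq_zero.1 (?_ : 2 * g 0 1 = 0)).resolve_left two_ne_zero
    linear_combination y * j₀ + x * k₀ + (g 0 1 + g 1 0) * hxy + i₀
  ext i j
  fin_cases i <;> fin_cases j <;> simp
  · exact ha
  · exact hb
  · linear_combination hb - i₀
  · linear_combination i₁ - ha

end

theorem exists_injective_perm_five_hom_pgl_semidirect {L : Type*} [Field L] [CharZero L]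
    (σ : L →+* L) (hσ : ∀ z, σ (σ z) = z) (s : L) (hs : s ^ 2 = 5) (hσs : σ s = -s)
    (h : ∃ x y : L, x ^ 2 + y ^ 2 = -1)
    (φ : Multiplicative (ZMod 2) →* MulAut PGL(2, L))
    (hφ : ∀ g : GL (Fin 2) L,
      φ (Multiplicative.ofAdd 1) (ProjGenLinGroup.mk g) = ProjGenLinGroup.mk (g.map σ)) :
    ∃ f : Equiv.Perm (Fin 5) →* PGL(2, L) ⋊[φ] Multiplicative (ZMod 2), Function.Injective f := by
  classical
  obtain ⟨x, y, hxy⟩ := h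
  obtain ⟨p, q, hpq, hp, hq, h1, h2⟩ := exists_quaternion_descent σ hσ x y hxy
  have hs0 : s ≠ 0 := by
    rintro rfl
    norm_num at hs
  have h4 : σ 4 = 4 := map_ofNat σ 4
  -- Conjugation by `C` after the entrywise action of `σ` acts on quaternion coordinates, by `hCQ`.
  let C : GL (Fin 2) L := GeneralLinearGroup.mkOfDetNeZero !![p, -q; q, p]
    (by simpa [det_fin_two, sq] using hpq)
  have hCQ (q₀ q₁ q₂ q₃ : L) : C.val * (quaternionMatrix x y q₀ q₁ q₂ q₃).map σ =
      quaternionMatrix x y (σ q₀) (σ q₁) (σ q₂) (σ q₃) * C.val := by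
    ext i j
    fin_cases i <;> fin_cases j <;>
      simp [C, quaternionMatrix, GeneralLinearGroup.mkOfDetNeZero, Matrix.mul_apply]
    · linear_combination σ q₂ * h1 - σ q₃ * h2
    · linear_combination σ q₃ * h1 + σ q₂ * h2
    · linear_combination σ q₃ * h1 + σ q₂ * h2
    · linear_combination -σ q₂ * h1 + σ q₃ * h2
  -- The vertices of the simplex: the negative scalar part `-1 / 4` makes them sum to zero, and
  -- `1 / 16 + 3 * s ^ 2 / 16 = 1` because `s ^ 2 = 5`.
  let V : Fin 5 → Matrix (Fin 2) (Fin 2) L :=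
    ![quaternionMatrix x y 1 0 0 0,
      quaternionMatrix x y (-1 / 4) (s / 4) (s / 4) (s / 4),
      quaternionMatrix x y (-1 / 4) (s / 4) (-s / 4) (-s / 4),
      quaternionMatrix x y (-1 / 4) (-s / 4) (s / 4) (-s / 4),
      quaternionMatrix x y (-1 / 4) (-s / 4) (-s / 4) (s / 4)]
  -- The units `i`, `j`, `i j` are linear combinations of the vertices, as are their conjugates.
  have hunit (k : Fin 3) : quaternionMatrix x y 0 (![1, 0, 0] k) (![0, 1, 0] k) (![0, 0, 1] k) =
      (2 / s) • (V 1 + V k.succ.succ + (1 / 2 : L) • V 0) := by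
    fin_cases k <;>
    · simp [V, quaternionMatrix_add, smul_quaternionMatrix]
      congr 1 <;> field
  have hunit' (k : Fin 3) :
      quaternionMatrix x y 0 (-![1, 0, 0] k) (-![0, 1, 0] k) (-![0, 0, 1] k) =
      (2 / s) • ((V 1).adjugate + (V k.succ.succ).adjugate + (1 / 2 : L) • (V 0).adjugate) := by
    fin_cases k <;>
    · simp [V, adjugate_quaternionMatrix, quaternionMatrix_add, smul_quaternionMatrix]
      congr 1 <;> field
  refine exists_injective_perm_five_hom σ φ hφ C ?_ V ?_ ?_ ?_ ?_ (fun g hg => ?_) (fun g hg => ?_)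
  · rw [mk_eq_one_iff]
    refine ⟨p ^ 2 + q ^ 2, ?_⟩
    ext i j
    fin_cases i <;> fin_cases j <;>
      simp [C, GeneralLinearGroup.mkOfDetNeZero, Matrix.mul_apply, hp, hq] <;> ring
  · intro a
    fin_cases a <;> simp [V, det_quaternionMatrix hxy] <;> linear_combination (3 / 16) * hs
  · intro a b hab
    fin_cases a <;> fin_cases b <;> first | exact absurd rfl hab | skip
    all_goals
      simp [V, trace_quaternionMatrix_mul_adjugate hxy]
      first | linear_combination (-1 / 8) * hs | norm_num
  · intro a
    fin_cases a <;> simp [V, adjugate_quaternionMatrix, hCQ, hσs, neg_div, h4]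
  · ext i j
    fin_cases i <;> fin_cases j <;> simp [V, quaternionMatrix]
  · have h (k : Fin 3) := by
      have := congrArg (g * ·) (hunit k)
      simp only [Matrix.mul_smul, Matrix.mul_add, hg] at this
      simpa only [← Matrix.smul_mul, ← Matrix.add_mul, ← hunit k] using this
    exact mem_range_scalar_of_commute_quaternionMatrix hxy (by simpa using h 0) (by simpa using h 1)
  · have h (k : Fin 3) := by
      have := congrArg (g * ·) (hunit' k)
      simp only [Matrix.mul_smul, Matrix.mul_add, hg] at this
      simpa only [← Matrix.smul_mul, ← Matrix.add_mul, ← hunit k] using this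
    exact eq_zero_of_anticommute_quaternionMatrix hxy (by simpa using h 0) (by simpa using h 1)
      (by simpa using h 2)

/-! ### The Jordan constant of the semidirect product -/

theorem mainTheorem7 {K L : Type*} [Field K] [CharZero K] [Field L] [Algebra K L]
    (h5 : ¬ ∃ x : K, x ^ 2 = 5)
    (s : L) (hs : s ^ 2 = 5) (hL : IntermediateField.adjoin K {s} = ⊤)
    (σ : L ≃ₐ[K] L) (hσ : orderOf σ = 2)
    (h : ∃ x y : L, x ^ 2 + y ^ 2 = -1) :
    jordanConstant (PGLSemidirect σ hσ) = 120 := by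
  have : CharZero L := charZero_of_injective_algebraMap (algebraMap K L).injective
  have hσσ (z : L) : σ (σ z) = z := by
    have := pow_orderOf_eq_one σ
    rw [hσ, sq] at this
    exact DFunLike.congr_fun this z
  have hσs : σ s = -s := by
    refine (sq_eq_sq_iff_eq_or_eq_neg.1 ?_).resolve_left fun hfix => ?_
    · rw [← map_pow, hs, map_ofNat]
    · have h1 : σ = 1 := by
        ext z
        have hz : z ∈ IntermediateField.adjoin K {s} := hL ▸ IntermediateField.mem_top
        induction hz using IntermediateField.adjoin_induction with
        | mem z hz => rwa [Set.mem_singleton_iff.1 hz]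
        | algebraMap k => exact σ.commutes k
        | add a b _ _ ha hb => simpa using congrArg₂ (· + ·) ha hb
        | inv a _ ha => simpa using congrArg (·⁻¹) ha
        | mul a b _ _ ha hb => simpa using congrArg₂ (· * ·) ha hb
      rw [h1, orderOf_one] at hσ
      omega
  refine le_antisymm (iSup₂_le fun G hG => ?_) ?_
  · exact_mod_cast finiteJordanConstant_le_of_semidirectProduct_pgl _ G
  · obtain ⟨f, hf⟩ := exists_injective_perm_five_hom_pgl_semidirect (σ : L →+* L) hσσ s hs hσs h
      ((galoisActionPGL K L).comp (involutionHom σ hσ)) fun g => by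
        have h1 : involutionHom σ hσ (Multiplicative.ofAdd 1) = σ := pow_one σ
        rw [MonoidHom.comp_apply, h1]
        rfl
    exact factorial_le_jordanConstant le_rfl f hf
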